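/- For a real matrix $M$ let $\|M\|$ denote its spectral norm and $\|M\|_F$ its Frobenius norm; for vectors $\|\cdot\|$ is the Euclidean norm. For every $c>0$ and every $\delta_0<1$ there is a constant $c'>0$, depending only on $c$ and $\delta_0$, such that the following holds. Let $A\in\mathbb{R}^{m\times n}$ and $B\in\mathbb{R}^{n\times d}$ with $\|A\|=\|B\|=1$, let $a_1,\dots,a_n$ be the columns of $A$ and $b_1^{\top},\dots,b_n^{\top}$ the rows of $B$, and let $p=(p_1,\dots,p_n)$ be a probability distribution on $\{1,\dots,n\}$ with $$p_i\;\ge\; c\left(\frac{\|a_i\|^2}{2\|A\|_F^2}+\frac{\|b_i\|^2}{2\|B\|_F^2}\right)\qquad\text{for all } i.$$ Let $0<\delta\le\delta_0$, let $k\ge 1$, and let $i_1,\dots,i_k$ be independent random indices, each with law $p$. Put $$\widetilde{AB}=\frac1k\sum_{j=1}^k\frac{1}{p_{i_j}}\,a_{i_j}b_{i_j}^{\top},\qquad t=\sqrt{\frac{c'\,\log(n)\,\log(1/\delta)\,\bigl(\|A\|_F^2+\|B\|_F^2\bigr)}{k}}.$$ If $t\le 1$ (that is, if $k\ge c'\log(n)\log(1/\delta)(\|A\|_F^2+\|B\|_F^2)$),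 then with probability at least $1-\delta$ $$\bigl\|\widetilde{AB}-AB\bigr\|\le t .$$ -/

import Mathlib

namespace AsymAMP

section
open scoped Matrix.Norms.Frobenius

/-- The Frobenius norm `(∑ i j, A i j ^ 2) ^ (1/2)`. -/
noncomputable def frobNorm {m n : ℕ} (A : Matrix (Fin m) (Fin n) ℝ) : ℝ := ‖A‖

end

section
open scoped Matrix.Norms.L2Operator

/-- The spectral norm: the operator norm of `A` between Euclidean spaces. -/
noncomputable def specNorm {m n : ℕ} (A : Matrix (Fin m) (Fin n) ℝ) : ℝ := ‖A‖

end

/-- The Euclidean norm of the `i`-th column of `A`. -/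
noncomputable def colNorm {m n : ℕ} (A : Matrix (Fin m) (Fin n) ℝ) (i : Fin n) : ℝ :=
  ‖WithLp.toLp 2 (A.col i)‖

/-- The Euclidean norm of the `i`-th row of `B`. -/
noncomputable def rowNorm {n d : ℕ} (B : Matrix (Fin n) (Fin d) ℝ) (i : Fin n) : ℝ :=
  ‖WithLp.toLp 2 (B.row i)‖

/-- `p` is a probability distribution on `Fin n`. -/
def IsProbVector {n : ℕ} (p : Fin n → ℝ) : Prop :=
  (∀ i, 0 ≤ p i) ∧ ∑ i, p i = 1

/-- `p` is, up to the factor `c`, at least the average of the squared-norm distributions of the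
columns of `A` and of the rows of `B`. -/
def Oversamples {m n d : ℕ} (c : ℝ) (p : Fin n → ℝ)
    (A : Matrix (Fin m) (Fin n) ℝ) (B : Matrix (Fin n) (Fin d) ℝ) : Prop :=
  ∀ i, c * (colNorm A i ^ 2 / (2 * frobNorm A ^ 2) + rowNorm B i ^ 2 / (2 * frobNorm B ^ 2)) ≤ p i

/-- The estimator `(1/k) ∑ j, (1/p_{I j}) a_{I j} b_{I j}ᵀ` of `A * B` given by the sampled
indices `I 0, …, I (k-1)`, with `a_i` the columns of `A` and `b_i` the rows of `B`. -/
noncomputable def estimator {m n d k : ℕ}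
    (A : Matrix (Fin m) (Fin n) ℝ) (B : Matrix (Fin n) (Fin d) ℝ) (p : Fin n → ℝ)
    (I : Fin k → Fin n) : Matrix (Fin m) (Fin d) ℝ :=
  (1 / (k : ℝ)) • ∑ j, (1 / p (I j)) • Matrix.vecMulVec (A.col (I j)) (B.row (I j))

/-- The error bound `√(c' log n log (1/δ) (‖A‖_F² + ‖B‖_F²) / k)`. -/
noncomputable def errorBound {m n d : ℕ} (c' δ : ℝ) (k : ℕ)
    (A : Matrix (Fin m) (Fin n) ℝ) (B : Matrix (Fin n) (Fin d) ℝ) : ℝ :=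
  √(c' * Real.log n * Real.log (1 / δ) * (frobNorm A ^ 2 + frobNorm B ^ 2) / k)

/-- The random indices `I 0, …, I (k-1)` are independent, each with law `p`. -/
def IsIIDSample {Ω : Type*} [MeasurableSpace Ω] (μ : MeasureTheory.Measure Ω) {n k : ℕ}
    (p : Fin n → ℝ) (I : Fin k → Ω → Fin n) : Prop :=
  (∀ j, Measurable (I j)) ∧ ProbabilityTheory.iIndepFun I μ ∧
    ∀ j i, μ.real (I j ⁻¹' {i}) = p i

end AsymAMP

/-! Stack the columns into z_i = (a_i; b_i) and put Y_i = z_i z_iᵀ / p_i. The mean M of Y_i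
satisfies 0 ≤ M ≤ 2 and has trace F = ‖A‖_F² + ‖B‖_F² ≤ 2n, and oversampling gives Y_i² ≤ L Y_i with
L = 2F/c. If X is the sum of the k centred samples, then k times the estimation error is an
off-diagonal block of X, so it suffices that ‖X‖ ≤ kt.

The norm of X is controlled through even trace moments, by the method of exchangeable pairs.
Resampling one index turns E tr X^(2s+2) into symmetrized differences of odd powers; the mean value
trace inequality `trace_sub_mul_pow_sub_pow_le` and Y_i² ≤ L Y_i bound these by E tr X^(2s+1) and E
tr (M X^(2s)) (`iidMean_trace_pow_le`). Completing a square and using M ≤ 2 makes this a recursion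
in even moments alone (`iidMean_trace_even_pow_le`). It starts from tr M instead of the dimension m
+ d, which is why only log n appears. Markov's inequality at a moment of order about 2(log n +
log(1/δ)) finishes the proof (`moment_bound_le`). -/

namespace AsymAMP

open Matrix

/-! ### Trace inequalities for Hermitian matrices. -/

/-- Chebyshev-type rearrangement for the two powers `q` and `s - q`. -/
lemma pow_mul_pow_add_le {a b : ℝ} {q s : ℕ} (hs : Even s) (hq : q ≤ s) :
    a ^ q * b ^ (s - q) + a ^ (s - q) * b ^ q ≤ a ^ s + b ^ s := by
  have habs : ∀ x y : ℝ, 0 ≤ x → 0 ≤ y →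
      x ^ q * y ^ (s - q) + x ^ (s - q) * y ^ q ≤ x ^ s + y ^ s := by
    intro x y hx hy
    have h1 : x ^ s = x ^ q * x ^ (s - q) := by rw [← pow_add, Nat.add_sub_cancel' hq]
    have h2 : y ^ s = y ^ q * y ^ (s - q) := by rw [← pow_add, Nat.add_sub_cancel' hq]
    have h3 : 0 ≤ (x ^ q - y ^ q) * (x ^ (s - q) - y ^ (s - q)) := by
      rcases le_total x y with h | h
      · exact mul_nonneg_of_nonpos_of_nonpos
          (sub_nonpos.2 (pow_le_pow_left₀ hx h _)) (sub_nonpos.2 (pow_le_pow_left₀ hx h _))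
      · exact mul_nonneg
          (sub_nonneg.2 (pow_le_pow_left₀ hy h _)) (sub_nonneg.2 (pow_le_pow_left₀ hy h _))
    rw [h1, h2]
    linarith
  -- Passing to absolute values leaves the right side unchanged, as `s` is even, and can only
  -- increase the left side.
  have h := habs |a| |b| (abs_nonneg a) (abs_nonneg b)
  rw [hs.pow_abs, hs.pow_abs] at h
  refine le_trans (add_le_add ?_ ?_) h <;>
  · rw [← abs_pow, ← abs_pow, ← abs_mul]
    exact le_abs_self _

/-- The scalar mean value inequality for odd powers. -/
lemma sub_mul_pow_sub_pow_le (a b : ℝ) (s : ℕ) :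
    (a - b) * (a ^ (2 * s + 1) - b ^ (2 * s + 1)) ≤
      (2 * s + 1) / 2 * ((a - b) ^ 2 * (a ^ (2 * s) + b ^ (2 * s))) := by
  have hgeom := Commute.geom_sum₂_mul (Commute.all a b) (2 * s + 1)
  have hrefl := Finset.sum_range_reflect (fun q => a ^ q * b ^ (2 * s - q)) (2 * s + 1)
  have hsum : 2 * ∑ q ∈ Finset.range (2 * s + 1), a ^ q * b ^ (2 * s - q) ≤
      (2 * s + 1) * (a ^ (2 * s) + b ^ (2 * s)) := by
    calc 2 * ∑ q ∈ Finset.range (2 * s + 1), a ^ q * b ^ (2 * s - q)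
        = ∑ q ∈ Finset.range (2 * s + 1),
            (a ^ q * b ^ (2 * s - q) + a ^ (2 * s - q) * b ^ q) := by
          rw [Finset.sum_add_distrib, two_mul]
          congr 1
          rw [← hrefl]
          refine Finset.sum_congr rfl fun q hq => ?_
          have : q ≤ 2 * s := Nat.lt_succ_iff.1 (Finset.mem_range.1 hq)
          rw [show 2 * s + 1 - 1 - q = 2 * s - q by omega, Nat.sub_sub_self this]
      _ ≤ ∑ q ∈ Finset.range (2 * s + 1), (a ^ (2 * s) + b ^ (2 * s)) :=
          Finset.sum_le_sum fun q hq => pow_mul_pow_add_le (even_two_mul s)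
            (Nat.lt_succ_iff.1 (Finset.mem_range.1 hq))
      _ = _ := by simp; ring
  have hgeom' : (∑ q ∈ Finset.range (2 * s + 1), a ^ q * b ^ (2 * s - q)) * (a - b) =
      a ^ (2 * s + 1) - b ^ (2 * s + 1) := by
    rw [← hgeom]
    simp
  rw [← hgeom']
  nlinarith [mul_le_mul_of_nonneg_left hsum (sq_nonneg (a - b))]

variable {D : Type*} [Fintype D] [DecidableEq D]

/-- A Hermitian real matrix is orthogonally diagonalizable. -/
lemma exists_diagonalization {X : Matrix D D ℝ} (hX : X.IsHermitian) :
    ∃ (U : Matrix D D ℝ) (l : D → ℝ), star U * U = 1 ∧ U * star U = 1 ∧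
      ∀ r : ℕ, X ^ r = U * diagonal (fun i => l i ^ r) * star U := by
  refine ⟨hX.eigenvectorUnitary, hX.eigenvalues, Unitary.coe_star_mul_self _,
    Unitary.coe_mul_star_self _, fun r => ?_⟩
  conv_lhs => rw [hX.spectral_theorem, ← map_pow, Matrix.diagonal_pow]
  rw [Unitary.conjStarAlgAut_apply]
  rfl

/-- Traces of mixed monomials in two Hermitian matrices, in terms of their eigenvalues. -/
lemma exists_trace_pow_mul_pow {X X' : Matrix D D ℝ} (hX : X.IsHermitian)
    (hX' : X'.IsHermitian) :
    ∃ (l u : D → ℝ) (g : D → D → ℝ), ∀ a b : ℕ,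
      trace (X ^ a * X' ^ b) = ∑ i, ∑ j, g i j ^ 2 * (l i ^ a * u j ^ b) := by
  obtain ⟨U, l, -, -, hU⟩ := exists_diagonalization hX
  obtain ⟨V, u, -, -, hV⟩ := exists_diagonalization hX'
  -- The weights are squared overlaps of the two eigenbases. Being nonnegative and independent of
  -- the exponents, they reduce trace inequalities to scalar ones for pairs of eigenvalues.
  refine ⟨l, u, fun i j => (star U * V) i j, fun a b => ?_⟩
  have h1 : trace (X ^ a * X' ^ b) = trace (diagonal (fun i => l i ^ a) * (star U * V) *
      diagonal (fun i => u i ^ b) * star (star U * V)) := by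
    rw [hU, hV, star_mul, star_star]
    simp only [Matrix.mul_assoc]
    rw [Matrix.trace_mul_comm]
    simp only [Matrix.mul_assoc]
  rw [h1]
  generalize star U * V = G
  rw [trace]
  simp_rw [diag_apply, Matrix.mul_apply (N := star G), mul_diagonal, diagonal_mul, star_apply,
    star_trivial]
  refine Finset.sum_congr rfl fun i _ => Finset.sum_congr rfl fun j _ => ?_
  ring

/-- The mean value trace inequality for odd powers of Hermitian matrices. -/
lemma trace_sub_mul_pow_sub_pow_le {X X' : Matrix D D ℝ} (hX : X.IsHermitian)
    (hX' : X'.IsHermitian) (s : ℕ) :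
    trace ((X - X') * (X ^ (2 * s + 1) - X' ^ (2 * s + 1))) ≤
      (2 * s + 1) / 2 * trace ((X - X') ^ 2 * (X ^ (2 * s) + X' ^ (2 * s))) := by
  obtain ⟨l, u, g, hg⟩ := exists_trace_pow_mul_pow hX hX'
  have hL : trace ((X - X') * (X ^ (2 * s + 1) - X' ^ (2 * s + 1))) =
      ∑ i, ∑ j, g i j ^ 2 * ((l i - u j) * (l i ^ (2 * s + 1) - u j ^ (2 * s + 1))) := by
    have e : trace ((X - X') * (X ^ (2 * s + 1) - X' ^ (2 * s + 1))) =
        trace (X ^ (2 * s + 2) * X' ^ 0) - trace (X ^ (2 * s + 1) * X' ^ 1)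
          - trace (X ^ 1 * X' ^ (2 * s + 1)) + trace (X ^ 0 * X' ^ (2 * s + 2)) := by
      rw [sub_mul, mul_sub, mul_sub, trace_sub, trace_sub, trace_sub,
        trace_mul_comm X' (X ^ (2 * s + 1)), ← pow_succ', ← pow_succ']
      simp only [pow_zero, pow_one, one_mul, mul_one]
      ring
    rw [e]
    simp only [hg, ← Finset.sum_add_distrib, ← Finset.sum_sub_distrib]
    refine Finset.sum_congr rfl fun i _ => Finset.sum_congr rfl fun j _ => ?_
    ring
  have hR : trace ((X - X') ^ 2 * (X ^ (2 * s) + X' ^ (2 * s))) =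
      ∑ i, ∑ j, g i j ^ 2 * ((l i - u j) ^ 2 * (l i ^ (2 * s) + u j ^ (2 * s))) := by
    have e : trace ((X - X') ^ 2 * (X ^ (2 * s) + X' ^ (2 * s))) =
        trace (X ^ (2 * s + 2) * X' ^ 0) + trace (X ^ 2 * X' ^ (2 * s))
          - trace (X ^ (2 * s + 1) * X' ^ 1) - trace (X ^ 1 * X' ^ (2 * s + 1))
          - trace (X ^ (2 * s + 1) * X' ^ 1) - trace (X ^ 1 * X' ^ (2 * s + 1))
          + trace (X ^ (2 * s) * X' ^ 2) + trace (X ^ 0 * X' ^ (2 * s + 2)) := by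
      -- By cyclicity every word in the expansion has the trace of some X^a X'^b.
      have h1 : trace (X * X' * X ^ (2 * s)) = trace (X ^ (2 * s + 1) * X') := by
        rw [Matrix.mul_assoc, trace_mul_comm, Matrix.mul_assoc, ← pow_succ, trace_mul_comm]
      have h2 : trace (X' * X * X ^ (2 * s)) = trace (X ^ (2 * s + 1) * X') := by
        rw [Matrix.mul_assoc, ← pow_succ', trace_mul_comm]
      have h3 : trace (X * X' * X' ^ (2 * s)) = trace (X * X' ^ (2 * s + 1)) := by
        rw [Matrix.mul_assoc, ← pow_succ']
      have h4 : trace (X' * X * X' ^ (2 * s)) = trace (X * X' ^ (2 * s + 1)) := by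
        rw [Matrix.mul_assoc, trace_mul_comm, Matrix.mul_assoc, ← pow_succ]
      have h5 : trace (X' ^ 2 * X ^ (2 * s)) = trace (X ^ (2 * s) * X' ^ 2) := trace_mul_comm _ _
      have h6 : X ^ (2 * s + 2) = X ^ 2 * X ^ (2 * s) := by rw [← pow_add, add_comm]
      have h7 : X' ^ (2 * s + 2) = X' ^ 2 * X' ^ (2 * s) := by rw [← pow_add, add_comm]
      have h8 : (X - X') ^ 2 = X ^ 2 - X * X' - X' * X + X' ^ 2 := by noncomm_ring
      rw [h8]
      simp only [mul_add, add_mul, sub_mul, trace_add, trace_sub, h1, h2, h3, h4, h5, h6, h7,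
        pow_zero, pow_one, one_mul, mul_one]
      ring
    rw [e]
    simp only [hg, ← Finset.sum_add_distrib, ← Finset.sum_sub_distrib]
    refine Finset.sum_congr rfl fun i _ => Finset.sum_congr rfl fun j _ => ?_
    ring
  rw [hL, hR]
  simp only [Finset.mul_sum]
  refine Finset.sum_le_sum fun i _ => Finset.sum_le_sum fun j _ => ?_
  have := mul_le_mul_of_nonneg_left (sub_mul_pow_sub_pow_le (l i) (u j) s) (sq_nonneg (g i j))
  linarith

/-- The trace of the product of a positive semidefinite matrix and an even power of a Hermitian
matrix is nonnegative. -/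
lemma trace_mul_even_pow_nonneg {P X : Matrix D D ℝ} (hP : P.PosSemidef) (hX : X.IsHermitian)
    (s : ℕ) : 0 ≤ trace (P * X ^ (2 * s)) := by
  -- The trace equals that of X^s P X^s, which is positive semidefinite.
  have h := (hP.mul_mul_conjTranspose_same (X ^ s)).trace_nonneg
  rwa [(hX.pow s).eq, trace_mul_comm, ← Matrix.mul_assoc, trace_mul_comm, ← pow_add,
    ← two_mul] at h

open scoped Matrix.Norms.L2Operator in
/-- A bound on an even trace moment bounds the operator norm. -/
lemma l2_opNorm_le_of_trace_pow_le {X : Matrix D D ℝ} (hX : X.IsHermitian) {t : ℝ} (ht : 0 ≤ t)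
    {q : ℕ} (hq : q ≠ 0) (h : trace (X ^ (2 * q)) ≤ t ^ (2 * q)) : ‖X‖ ≤ t := by
  obtain ⟨U, l, h1, h2, hU⟩ := exists_diagonalization hX
  have htr : trace (X ^ (2 * q)) = ∑ i, l i ^ (2 * q) := by
    rw [hU, trace_mul_comm, ← Matrix.mul_assoc, h1, Matrix.one_mul, trace_diagonal]
  have hl : ‖l‖ ≤ t := by
    refine (pi_norm_le_iff_of_nonneg ht).2 fun i => ?_
    have h3 : |l i| ^ (2 * q) ≤ t ^ (2 * q) := by
      rw [(even_two_mul q).pow_abs]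
      refine le_trans ?_ (htr ▸ h)
      exact Finset.single_le_sum (f := fun i => l i ^ (2 * q))
        (fun j _ => (even_two_mul q).pow_nonneg _) (Finset.mem_univ i)
    exact le_of_pow_le_pow_left₀ (by omega) ht h3
  have hUm : U ∈ unitary (Matrix D D ℝ) := ⟨h1, h2⟩
  have hX1 : X = U * diagonal l * star U := by simpa using hU 1
  rw [hX1, CStarRing.norm_mul_mem_unitary _ (Unitary.star_mem hUm),
    CStarRing.norm_mem_unitary_mul _ hUm, l2_opNorm_diagonal]
  exact hl

end AsymAMP

/-! ### Moments of the centred sum by exchangeable pairs. -/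

namespace AsymAMP

open Matrix

variable {D : Type*} {ι : Type*} [Fintype ι] {k : ℕ}

/-- The mean of `f` over `k` independent samples from the weights `p`. -/
noncomputable def iidMean (p : ι → ℝ) (f : (Fin k → ι) → ℝ) : ℝ :=
  ∑ I, (∏ j, p (I j)) * f I

lemma iidMean_mono {p : ι → ℝ} (hp : ∀ i, 0 ≤ p i) {f g : (Fin k → ι) → ℝ}
    (h : ∀ I, f I ≤ g I) : iidMean p f ≤ iidMean p g :=
  Finset.sum_le_sum fun I _ =>
    mul_le_mul_of_nonneg_left (h I) (Finset.prod_nonneg fun _ _ => hp _)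

lemma iidMean_add (p : ι → ℝ) (f g : (Fin k → ι) → ℝ) :
    iidMean p (fun I => f I + g I) = iidMean p f + iidMean p g := by
  simp [iidMean, mul_add, Finset.sum_add_distrib]

lemma iidMean_const_mul (p : ι → ℝ) (a : ℝ) (f : (Fin k → ι) → ℝ) :
    iidMean p (fun I => a * f I) = a * iidMean p f := by
  simp only [iidMean, Finset.mul_sum]
  exact Finset.sum_congr rfl fun I _ => by ring

lemma iidMean_sum {κ : Type*} [Fintype κ] (p : ι → ℝ) (f : κ → (Fin k → ι) → ℝ) :
    iidMean p (fun I => ∑ j, f j I) = ∑ j, iidMean p (f j) := by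
  simp only [iidMean, Finset.mul_sum]
  exact Finset.sum_comm

lemma iidMean_const {p : ι → ℝ} (hp : ∑ i, p i = 1) (a : ℝ) :
    iidMean p (fun _ : Fin k → ι => a) = a := by
  have h := Finset.prod_univ_sum (fun _ : Fin k => (Finset.univ : Finset ι)) (fun _ i => p i)
  simp only [hp, Finset.prod_const_one, Fintype.piFinset_univ] at h
  rw [iidMean, ← Finset.sum_mul, ← h, one_mul]

/-- Resampling one coordinate gives an exchangeable pair. -/
lemma iidMean_sum_update_swap (p : ι → ℝ) (j : Fin k)
    (G : (Fin k → ι) → (Fin k → ι) → ℝ) :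
    iidMean p (fun I => ∑ i, p i * G I (Function.update I j i)) =
      iidMean p (fun I => ∑ i, p i * G (Function.update I j i) I) := by
  simp only [iidMean, Finset.mul_sum]
  rw [← Fintype.sum_prod_type', ← Fintype.sum_prod_type']
  have hw : ∀ (I : Fin k → ι) (i : ι),
      (∏ l, p (Function.update I j i l)) * p (I j) = (∏ l, p (I l)) * p i := by
    intro I i
    rw [Fintype.prod_eq_mul_prod_compl j, Fintype.prod_eq_mul_prod_compl j (fun l => p (I l))]
    have : ∏ l ∈ {j}ᶜ, p (Function.update I j i l) = ∏ l ∈ {j}ᶜ, p (I l) := by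
      refine Finset.prod_congr rfl fun l hl => ?_
      rw [Function.update_of_ne (by simpa using hl)]
    rw [this, Function.update_self]
    ring
  -- Swapping the old and the new value of coordinate `j` is an involution that preserves the joint
  -- weight.
  let e : ((Fin k → ι) × ι) → ((Fin k → ι) × ι) := fun x => (Function.update x.1 j x.2, x.1 j)
  have he : Function.Involutive e := fun x => by simp [e]
  refine Fintype.sum_bijective e he.bijective _ _ fun x => ?_
  simp only [e, Function.update_idem, Function.update_eq_self]
  rw [← mul_assoc, ← mul_assoc, hw]

/-- The centred sum of the sampled matrices. -/
noncomputable def centredSum (p : ι → ℝ) (Y : ι → Matrix D D ℝ) (I : Fin k → ι) :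
    Matrix D D ℝ :=
  ∑ j, (Y (I j) - ∑ i, p i • Y i)

lemma centredSum_isHermitian {p : ι → ℝ} {Y : ι → Matrix D D ℝ} (hY : ∀ i, (Y i).IsHermitian)
    (I : Fin k → ι) : (centredSum p Y I).IsHermitian := by
  have hs : ∀ i, (Y i)ᴴ = Y i := fun i => (hY i).eq
  simp only [centredSum, IsHermitian, conjTranspose_sum, conjTranspose_sub, conjTranspose_smul,
    hs, star_trivial]

lemma centredSum_sub_update (p : ι → ℝ) (Y : ι → Matrix D D ℝ) (I : Fin k → ι) (j : Fin k)
    (i : ι) :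
    centredSum p Y I - centredSum p Y (Function.update I j i) = Y (I j) - Y i := by
  rw [centredSum, centredSum, ← Finset.sum_sub_distrib, Finset.sum_eq_single j]
  · simp
  · intro l _ hl
    simp [Function.update_of_ne hl]
  · simp

variable [Fintype D]

lemma trace_sum_smul_mul (p : ι → ℝ) (Y : ι → Matrix D D ℝ) (Q : Matrix D D ℝ) :
    trace ((∑ i, p i • Y i) * Q) = ∑ i, p i * trace (Y i * Q) := by
  rw [Finset.sum_mul, trace_sum]
  exact Finset.sum_congr rfl fun i _ => by rw [smul_mul, trace_smul, smul_eq_mul]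

lemma trace_sub_sum_smul_mul {p : ι → ℝ} (hp : ∑ i, p i = 1) (Y : ι → Matrix D D ℝ)
    (C Q : Matrix D D ℝ) :
    trace ((C - ∑ i, p i • Y i) * Q) = ∑ i, p i * trace ((C - Y i) * Q) := by
  simp only [sub_mul, trace_sub, trace_sum_smul_mul, mul_sub, Finset.sum_sub_distrib,
    ← Finset.sum_mul, hp, one_mul]

variable [DecidableEq D]

/-- One summand of the moment recursion, obtained from the exchangeable pair that resamples the
`j`-th index. -/
lemma iidMean_trace_summand_le {p : ι → ℝ} (hp0 : ∀ i, 0 ≤ p i) (hp : ∑ i, p i = 1)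
    {Y : ι → Matrix D D ℝ} (hY : ∀ i, (Y i).IsHermitian) {L : ℝ}
    (hL : ∀ i, (L • Y i - Y i ^ 2).PosSemidef) (j : Fin k) (s : ℕ) :
    iidMean p (fun I : Fin k → ι =>
        trace ((Y (I j) - ∑ i, p i • Y i) * centredSum p Y I ^ (2 * s + 1))) ≤
      (2 * s + 1) * L * iidMean p (fun I : Fin k → ι =>
        trace ((Y (I j) + ∑ i, p i • Y i) * centredSum p Y I ^ (2 * s))) := by
  set X : (Fin k → ι) → Matrix D D ℝ := centredSum p Y with hXdef
  have hX : ∀ I, (X I).IsHermitian := centredSum_isHermitian hY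
  have hdiff : ∀ I i, X I - X (Function.update I j i) = Y (I j) - Y i :=
    fun I i => centredSum_sub_update p Y I j i
  set G : (Fin k → ι) → (Fin k → ι) → ℝ :=
    fun I I' => trace ((X I - X I') * X I ^ (2 * s + 1)) with hG
  set H : (Fin k → ι) → (Fin k → ι) → ℝ :=
    fun I I' => trace ((X I - X I') ^ 2 * X I ^ (2 * s)) with hH
  -- Symmetrizing `G` produces the difference of odd powers to which the mean value trace inequality
  -- applies.
  have hGH : ∀ I I', G I I' + G I' I ≤ (2 * s + 1) / 2 * (H I I' + H I' I) := by
    intro I I'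
    have h := trace_sub_mul_pow_sub_pow_le (hX I) (hX I') s
    have e1 : G I I' + G I' I = trace ((X I - X I') * (X I ^ (2 * s + 1) - X I' ^ (2 * s + 1))) := by
      rw [hG, mul_sub, trace_sub]
      simp only
      rw [← neg_sub (X I) (X I'), neg_mul, trace_neg]
      ring
    have e2 : H I I' + H I' I = trace ((X I - X I') ^ 2 * (X I ^ (2 * s) + X I' ^ (2 * s))) := by
      rw [hH, mul_add, trace_add]
      simp only
      rw [← neg_sub (X I) (X I'), neg_sq]
    rw [e1, e2]
    exact h
  have hHle : ∀ I i, H I (Function.update I j i) ≤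
      2 * L * trace (Y (I j) * X I ^ (2 * s)) + 2 * L * trace (Y i * X I ^ (2 * s)) := by
    intro I i
    -- In the positive semidefinite order, (Y - Y')² ≤ 2Y² + 2Y'² ≤ 2L(Y + Y').
    have h1 := trace_mul_even_pow_nonneg (hL (I j)) (hX I) s
    have h2 := trace_mul_even_pow_nonneg (hL i) (hX I) s
    have h3 : ((Y (I j) + Y i) ^ 2).PosSemidef := by
      have := posSemidef_conjTranspose_mul_self (Y (I j) + Y i)
      rwa [((hY (I j)).add (hY i)).eq, ← pow_two] at this
    have h4 := trace_mul_even_pow_nonneg h3 (hX I) s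
    have h5 : (Y (I j) - Y i) ^ 2 = (2 : ℝ) • Y (I j) ^ 2 + (2 : ℝ) • Y i ^ 2 - (Y (I j) + Y i) ^ 2 := by
      rw [two_smul, two_smul]
      noncomm_ring
    simp only [sub_mul, trace_sub, smul_mul, trace_smul, smul_eq_mul] at h1 h2
    simp only [hH, hdiff, h5, sub_mul, add_mul, smul_mul, trace_sub, trace_add, trace_smul,
      smul_eq_mul]
    linarith
  have hswapG := iidMean_sum_update_swap p j G
  have hswapH := iidMean_sum_update_swap p j H
  have hlhs : iidMean p (fun I : Fin k → ι =>
        trace ((Y (I j) - ∑ i, p i • Y i) * X I ^ (2 * s + 1))) =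
      iidMean p (fun I => ∑ i, p i * G I (Function.update I j i)) := by
    simp only [hG, hdiff, trace_sub_sum_smul_mul hp]
  have hmain : iidMean p (fun I => ∑ i, p i * G I (Function.update I j i)) +
      iidMean p (fun I => ∑ i, p i * G (Function.update I j i) I) ≤
      (2 * s + 1) / 2 * (iidMean p (fun I => ∑ i, p i * H I (Function.update I j i)) +
      iidMean p (fun I => ∑ i, p i * H (Function.update I j i) I)) := by
    rw [← iidMean_add, ← iidMean_add, ← iidMean_const_mul]
    refine iidMean_mono hp0 fun I => ?_
    rw [← Finset.sum_add_distrib, ← Finset.sum_add_distrib, Finset.mul_sum]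
    refine Finset.sum_le_sum fun i _ => ?_
    have := mul_le_mul_of_nonneg_left (hGH I (Function.update I j i)) (hp0 i)
    linarith
  have hHmean : iidMean p (fun I => ∑ i, p i * H I (Function.update I j i)) ≤
      2 * L * iidMean p (fun I : Fin k → ι =>
        trace ((Y (I j) + ∑ i, p i • Y i) * X I ^ (2 * s))) := by
    rw [← iidMean_const_mul]
    refine iidMean_mono hp0 fun I => ?_
    calc ∑ i, p i * H I (Function.update I j i)
        ≤ ∑ i, p i * (2 * L * trace (Y (I j) * X I ^ (2 * s)) +
            2 * L * trace (Y i * X I ^ (2 * s))) :=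
          Finset.sum_le_sum fun i _ => mul_le_mul_of_nonneg_left (hHle I i) (hp0 i)
      _ = _ := by
          rw [add_mul, trace_add, trace_sum_smul_mul, mul_add, Finset.mul_sum]
          simp only [mul_add, Finset.sum_add_distrib, ← Finset.sum_mul, hp, one_mul]
          congr 1
          exact Finset.sum_congr rfl fun i _ => by ring
  rw [hlhs]
  rw [← hswapG, ← hswapH] at hmain
  have hs : (0 : ℝ) ≤ (2 * s + 1) / 2 := by positivity
  have := mul_le_mul_of_nonneg_left hHmean hs
  linarith

/-- The moment recursion. -/
lemma iidMean_trace_pow_le {p : ι → ℝ} (hp0 : ∀ i, 0 ≤ p i) (hp : ∑ i, p i = 1)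
    {Y : ι → Matrix D D ℝ} (hY : ∀ i, (Y i).IsHermitian) {L : ℝ}
    (hL : ∀ i, (L • Y i - Y i ^ 2).PosSemidef) (s : ℕ) :
    iidMean p (fun I : Fin k → ι => trace (centredSum p Y I ^ (2 * s + 2))) ≤
      (2 * s + 1) * L *
        (iidMean p (fun I : Fin k → ι => trace (centredSum p Y I ^ (2 * s + 1))) +
          2 * k * iidMean p (fun I : Fin k → ι =>
            trace ((∑ i, p i • Y i) * centredSum p Y I ^ (2 * s)))) := by
  set M : Matrix D D ℝ := ∑ i, p i • Y i with hM
  have h1 : iidMean p (fun I : Fin k → ι => trace (centredSum p Y I ^ (2 * s + 2))) =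
      ∑ j, iidMean p (fun I : Fin k → ι =>
        trace ((Y (I j) - M) * centredSum p Y I ^ (2 * s + 1))) := by
    rw [← iidMean_sum]
    congr 1
    funext I
    rw [← trace_sum, ← Finset.sum_mul, show 2 * s + 2 = 2 * s + 1 + 1 from rfl, pow_succ']
    rfl
  have h2 : ∑ j, iidMean p (fun I : Fin k → ι =>
        trace ((Y (I j) + M) * centredSum p Y I ^ (2 * s))) =
      iidMean p (fun I : Fin k → ι => trace (centredSum p Y I ^ (2 * s + 1))) +
          2 * k * iidMean p (fun I : Fin k → ι => trace (M * centredSum p Y I ^ (2 * s))) := by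
    rw [← iidMean_sum, ← iidMean_const_mul, ← iidMean_add]
    congr 1
    funext I
    have h3 : ∑ j, (Y (I j) + M) = centredSum p Y I + (2 * k : ℝ) • M := by
      rw [centredSum, ← hM, Finset.sum_add_distrib, Finset.sum_sub_distrib]
      simp only [Finset.sum_const, Finset.card_univ, Fintype.card_fin]
      rw [← Nat.cast_smul_eq_nsmul ℝ]
      module
    rw [← trace_sum, ← Finset.sum_mul, h3, add_mul, ← pow_succ', trace_add, smul_mul, trace_smul,
      smul_eq_mul]
  rw [h1, ← h2, Finset.mul_sum]
  exact Finset.sum_le_sum fun j _ => iidMean_trace_summand_le hp0 hp hY hL j s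

/-- The difference of old and resampled traces is antisymmetric under the exchange, so its mean is
its own negative. This removes the first moment at the start of the recursion. -/
lemma iidMean_trace_centredSum {p : ι → ℝ} (hp : ∑ i, p i = 1) (Y : ι → Matrix D D ℝ) :
    iidMean p (fun I : Fin k → ι => trace (centredSum p Y I)) = 0 := by
  simp only [centredSum, trace_sum]
  rw [iidMean_sum]
  refine Finset.sum_eq_zero fun j _ => ?_
  have h := iidMean_sum_update_swap p j (fun I I' => trace (Y (I j)) - trace (Y (I' j)))
  have e : (fun I : Fin k → ι => trace (Y (I j) - ∑ i, p i • Y i)) =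
      fun I => ∑ i, p i * (trace (Y (I j)) - trace (Y (Function.update I j i j))) := by
    funext I
    simpa [trace_sub] using trace_sub_sum_smul_mul hp Y (Y (I j)) 1
  have e' : (fun I : Fin k → ι =>
      ∑ i, p i * (trace (Y (Function.update I j i j)) - trace (Y (I j)))) =
      fun I => (-1) * ∑ i, p i * (trace (Y (I j)) - trace (Y (Function.update I j i j))) := by
    funext I
    rw [Finset.mul_sum]
    exact Finset.sum_congr rfl fun i _ => by ring
  rw [e', iidMean_const_mul] at h
  rw [e]
  linarith

/-- A bound on all even trace moments of the centred sum. -/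
lemma iidMean_trace_even_pow_le {p : ι → ℝ} (hp0 : ∀ i, 0 ≤ p i) (hp : ∑ i, p i = 1)
    {Y : ι → Matrix D D ℝ} (hY : ∀ i, (Y i).IsHermitian) {L b : ℝ} (hL0 : 0 ≤ L) (hb : 0 ≤ b)
    (hL : ∀ i, (L • Y i - Y i ^ 2).PosSemidef)
    (hM : (b • (1 : Matrix D D ℝ) - ∑ i, p i • Y i).PosSemidef)
    {R : ℝ} (s : ℕ) (hs : 2 * s + 1 ≤ R) :
    iidMean p (fun I : Fin k → ι => trace (centredSum p Y I ^ (2 * s + 2))) ≤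
      ((R * L) ^ 2 + 4 * k * b * (R * L)) ^ s * (2 * k * L * trace (∑ i, p i • Y i)) := by
  set X : (Fin k → ι) → Matrix D D ℝ := centredSum p Y with hXdef
  have hX : ∀ I, (X I).IsHermitian := centredSum_isHermitian hY
  -- `R` dominates every odd coefficient 2s + 1 that occurs, so all steps share one growth factor.
  -- The base case leaves tr M, with no dependence on the size of `D`.
  induction s with
  | zero =>
    have h := iidMean_trace_pow_le (k := k) hp0 hp hY hL 0
    simp only [Nat.cast_zero, mul_zero, zero_add, one_mul, pow_one, pow_zero, mul_one] at h ⊢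
    rw [iidMean_trace_centredSum hp, iidMean_const hp] at h
    linarith
  | succ s ih =>
    have hcast : 2 * ((s : ℝ) + 1) + 1 ≤ R := by exact_mod_cast hs
    have ih' := ih (by linarith)
    have hR : (0 : ℝ) ≤ R := le_trans (by positivity) hcast
    have h := iidMean_trace_pow_le (k := k) hp0 hp hY hL (s + 1)
    rw [← hXdef] at h
    set m : ℝ := iidMean p (fun I => trace (X I ^ (2 * s + 2))) with hm
    have hm0 : 0 ≤ m := by
      rw [hm, ← iidMean_const (k := k) hp (0 : ℝ)]
      refine iidMean_mono hp0 fun I => ?_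
      have := trace_mul_even_pow_nonneg PosSemidef.one (hX I) (s + 1)
      rwa [Matrix.one_mul] at this
    set a : ℝ := (2 * ((s : ℝ) + 1) + 1) * L with ha
    have ha0 : 0 ≤ a := by positivity
    have haR : a ≤ R * L := mul_le_mul_of_nonneg_right hcast hL0
    -- Since (X - a)² X^(2s+2) has nonnegative trace, the odd moment is bounded by neighbouring even
    -- ones. The half of the top moment is absorbed on the left in `h5`, doubling the other terms.
    have h1 : a * iidMean p (fun I => trace (X I ^ (2 * (s + 1) + 1))) ≤
        1 / 2 * iidMean p (fun I => trace (X I ^ (2 * (s + 1) + 2))) + 1 / 2 * a ^ 2 * m := by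
      rw [hm, ← iidMean_const_mul, ← iidMean_const_mul, ← iidMean_const_mul, ← iidMean_add]
      refine iidMean_mono hp0 fun I => ?_
      have hP : ((X I - a • 1) ^ 2).PosSemidef := by
        have h2 : (X I - a • 1).IsHermitian := (hX I).sub (by
          simp [IsHermitian])
        have := posSemidef_conjTranspose_mul_self (X I - a • 1)
        rwa [h2.eq, ← pow_two] at this
      have h3 := trace_mul_even_pow_nonneg hP (hX I) (s + 1)
      have h4 : (X I - a • 1) ^ 2 * X I ^ (2 * (s + 1)) =
          X I ^ (2 * (s + 1) + 2) - (2 * a) • X I ^ (2 * (s + 1) + 1) +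
            a ^ 2 • X I ^ (2 * s + 2) := by
        have e1 : (X I - a • 1) ^ 2 = X I ^ 2 - (2 * a) • X I + a ^ 2 • 1 := by
          rw [pow_two, sub_mul, mul_sub, mul_sub, ← pow_two]
          simp only [smul_mul, Matrix.mul_smul, Matrix.one_mul, Matrix.mul_one, smul_smul]
          module
        rw [e1, add_mul, sub_mul, smul_mul, smul_mul, Matrix.one_mul, ← pow_add, ← pow_succ',
          add_comm 2]
        rfl
      rw [h4] at h3
      simp only [trace_add, trace_sub, trace_smul, smul_eq_mul] at h3
      linarith
    have h2 : iidMean p (fun I => trace ((∑ i, p i • Y i) * X I ^ (2 * (s + 1)))) ≤ b * m := by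
      rw [hm, ← iidMean_const_mul]
      refine iidMean_mono hp0 fun I => ?_
      have := trace_mul_even_pow_nonneg hM (hX I) (s + 1)
      rw [sub_mul, trace_sub, smul_mul, Matrix.one_mul, trace_smul, smul_eq_mul] at this
      have e : X I ^ (2 * s + 2) = X I ^ (2 * (s + 1)) := rfl
      rw [e]
      linarith
    push_cast at h
    rw [← ha] at h
    have h2' := mul_le_mul_of_nonneg_left h2 (by positivity : 0 ≤ 2 * (k : ℝ) * a)
    have h5 : iidMean p (fun I => trace (X I ^ (2 * (s + 1) + 2))) ≤
        (a ^ 2 + 4 * k * b * a) * m := by linarith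
    have h6 : a ^ 2 + 4 * k * b * a ≤ (R * L) ^ 2 + 4 * k * b * (R * L) := by gcongr
    calc _ ≤ (a ^ 2 + 4 * k * b * a) * m := h5
      _ ≤ ((R * L) ^ 2 + 4 * k * b * (R * L)) * m := mul_le_mul_of_nonneg_right h6 hm0
      _ ≤ ((R * L) ^ 2 + 4 * k * b * (R * L)) * _ :=
          mul_le_mul_of_nonneg_left ih' (by positivity)
      _ = _ := by rw [pow_succ']; ring

end AsymAMP

/-! ### Law of the sample and Markov's inequality. -/

namespace AsymAMP

open Matrix MeasureTheory

/-- The law of an i.i.d. sample from `p` is the product of the weights. -/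
lemma IsIIDSample.measureReal_preimage_singleton {Ω : Type*} [MeasurableSpace Ω] {μ : Measure Ω}
    {n k : ℕ} {p : Fin n → ℝ} {I : Fin k → Ω → Fin n} (h : IsIIDSample μ p I)
    (J : Fin k → Fin n) : μ.real {ω | (fun j => I j ω) = J} = ∏ j, p (J j) := by
  have h1 := h.2.1.measure_inter_preimage_eq_mul Finset.univ (sets := fun j => {J j})
    (fun j _ => measurableSet_singleton _)
  have h2 : {ω | (fun j => I j ω) = J} = ⋂ j ∈ Finset.univ, I j ⁻¹' {J j} := by
    ext ω
    simp [funext_iff]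
  rw [h2, measureReal_def, h1, ENNReal.toReal_prod]
  exact Finset.prod_congr rfl fun j _ => h.2.2 j (J j)

/-- Markov's inequality for functions of an i.i.d. sample. -/
lemma IsIIDSample.measureReal_mul_le_iidMean {Ω : Type*} [MeasurableSpace Ω] {μ : Measure Ω}
    [IsProbabilityMeasure μ] {n k : ℕ} {p : Fin n → ℝ} {I : Fin k → Ω → Fin n}
    (h : IsIIDSample μ p I) (hp : ∀ i, 0 ≤ p i) {f : (Fin k → Fin n) → ℝ} (hf : ∀ J, 0 ≤ f J)
    (P : (Fin k → Fin n) → Prop) {τ : ℝ} (hP : ∀ J, P J → τ ≤ f J) :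
    μ.real {ω | P (fun j => I j ω)} * τ ≤ iidMean p f := by
  classical
  have hmeas : ∀ J, MeasurableSet {ω | (fun j => I j ω) = J} := fun J =>
    (measurable_pi_lambda _ h.1) (measurableSet_singleton J)
  have hset : {ω | P (fun j => I j ω)} =
      ⋃ J ∈ Finset.univ.filter P, {ω | (fun j => I j ω) = J} := by
    ext ω
    simp
  have hdisj : Set.PairwiseDisjoint (Finset.univ.filter P : Set (Fin k → Fin n))
      (fun J => {ω | (fun j => I j ω) = J}) := by
    intro J _ J' _ hne
    refine Set.disjoint_left.2 fun ω h1 h2 => hne ?_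
    exact Eq.trans (Eq.symm h1) h2
  rw [hset, measureReal_biUnion_finset hdisj fun J _ => hmeas J, Finset.sum_mul, iidMean,
    Finset.sum_filter]
  refine Finset.sum_le_sum fun J _ => ?_
  have hw : 0 ≤ ∏ j, p (J j) := Finset.prod_nonneg fun _ _ => hp _
  split_ifs with hJ
  · rw [h.measureReal_preimage_singleton]
    exact mul_le_mul_of_nonneg_left (hP J hJ) hw
  · exact mul_nonneg hw (hf J)

/-! ### Spectral, Frobenius and Euclidean norms. -/

section Norms

variable {m n d : ℕ}

lemma colNorm_sq (A : Matrix (Fin m) (Fin n) ℝ) (i : Fin n) :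
    colNorm A i ^ 2 = A.col i ⬝ᵥ A.col i := by
  rw [colNorm, EuclideanSpace.norm_sq_eq]
  simp [dotProduct, pow_two]

lemma rowNorm_sq (B : Matrix (Fin n) (Fin d) ℝ) (i : Fin n) :
    rowNorm B i ^ 2 = B.row i ⬝ᵥ B.row i := by
  rw [rowNorm, EuclideanSpace.norm_sq_eq]
  simp [dotProduct, pow_two]

open scoped Matrix.Norms.Frobenius in
lemma frobNorm_sq (A : Matrix (Fin m) (Fin n) ℝ) :
    frobNorm A ^ 2 = ∑ i, ∑ j, A i j ^ 2 := by
  have h : (0 : ℝ) ≤ ∑ i, ∑ j, A i j ^ 2 := by positivity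
  rw [frobNorm, frobenius_norm_def, ← Real.rpow_natCast, ← Real.rpow_mul (by positivity)]
  simp

open scoped Matrix.Norms.Frobenius in
lemma frobNorm_pos {A : Matrix (Fin m) (Fin n) ℝ} (hA : A ≠ 0) : 0 < frobNorm A :=
  norm_pos_iff.2 hA

lemma frobNorm_sq_eq_sum_colNorm (A : Matrix (Fin m) (Fin n) ℝ) :
    frobNorm A ^ 2 = ∑ i, colNorm A i ^ 2 := by
  rw [frobNorm_sq, Finset.sum_comm]
  refine Finset.sum_congr rfl fun i _ => ?_
  rw [colNorm_sq]
  simp [dotProduct, pow_two]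

open scoped Matrix.Norms.L2Operator

lemma specNorm_zero : specNorm (0 : Matrix (Fin m) (Fin n) ℝ) = 0 := norm_zero

lemma ne_zero_of_specNorm_eq_one {A : Matrix (Fin m) (Fin n) ℝ} (hA : specNorm A = 1) :
    A ≠ 0 := by
  rintro rfl
  rw [specNorm_zero] at hA
  exact zero_ne_one hA

lemma dotProduct_self_mulVec_le {D E : Type*} [Fintype D] [Fintype E] [DecidableEq E]
    (A : Matrix D E ℝ) (x : E → ℝ) :
    (A *ᵥ x) ⬝ᵥ (A *ᵥ x) ≤ ‖A‖ ^ 2 * (x ⬝ᵥ x) := by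
  have h := A.l2_opNorm_mulVec (WithLp.toLp 2 x)
  have h1 : ∀ {κ : Type _} [Fintype κ] (y : κ → ℝ), y ⬝ᵥ y = ‖WithLp.toLp 2 y‖ ^ 2 := by
    intro κ _ y
    rw [EuclideanSpace.norm_sq_eq]
    simp [dotProduct, pow_two]
  have h2 : x ⬝ᵥ x = ‖WithLp.toLp 2 x‖ ^ 2 := by
    rw [EuclideanSpace.norm_sq_eq]
    simp [dotProduct, pow_two]
  rw [h1, h2, ← mul_pow]
  exact pow_le_pow_left₀ (norm_nonneg _) h 2

lemma dotProduct_self_mulVec_le_of_specNorm {A : Matrix (Fin m) (Fin n) ℝ}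
    (hA : specNorm A = 1) (x : Fin n → ℝ) : (A *ᵥ x) ⬝ᵥ (A *ᵥ x) ≤ x ⬝ᵥ x := by
  have h := dotProduct_self_mulVec_le A x
  rw [specNorm] at hA
  rwa [hA, one_pow, one_mul] at h

lemma specNorm_transpose (A : Matrix (Fin m) (Fin n) ℝ) : specNorm Aᵀ = specNorm A :=
  l2_opNorm_conjTranspose A

lemma colNorm_sq_le_one {A : Matrix (Fin m) (Fin n) ℝ} (hA : specNorm A = 1) (i : Fin n) :
    colNorm A i ^ 2 ≤ 1 := by
  have h := dotProduct_self_mulVec_le_of_specNorm hA (Pi.single i 1)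
  rw [colNorm_sq]
  simpa using h

/-- Each column is the image of a unit vector. The resulting bound F ≤ 2n ties the final logarithm
to `n` alone. -/
lemma frobNorm_sq_le {A : Matrix (Fin m) (Fin n) ℝ} (hA : specNorm A = 1) :
    frobNorm A ^ 2 ≤ n := by
  rw [frobNorm_sq_eq_sum_colNorm]
  refine (Finset.sum_le_sum fun i _ => colNorm_sq_le_one hA i).trans ?_
  simp

lemma frobNorm_transpose (A : Matrix (Fin m) (Fin n) ℝ) : frobNorm Aᵀ ^ 2 = frobNorm A ^ 2 := by
  rw [frobNorm_sq, frobNorm_sq, Finset.sum_comm]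
  rfl

/-- The norm of an off-diagonal block is at most the norm of the matrix. -/
lemma l2_opNorm_toBlocks₁₂_le {D E : Type*} [Fintype D] [Fintype E] [DecidableEq D]
    [DecidableEq E] (X : Matrix (D ⊕ E) (D ⊕ E) ℝ) : ‖X.toBlocks₁₂‖ ≤ ‖X‖ := by
  rw [l2_opNorm_def X.toBlocks₁₂]
  refine ContinuousLinearMap.opNorm_le_bound _ (norm_nonneg _) fun v => ?_
  -- Padding the vector with zeros preserves its norm, and restricting the image to the first block
  -- only decreases it.
  have h := dotProduct_self_mulVec_le X (Sum.elim 0 v.ofLp)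
  have h1 : (X.toBlocks₁₂ *ᵥ v.ofLp) ⬝ᵥ (X.toBlocks₁₂ *ᵥ v.ofLp) ≤
      (X *ᵥ Sum.elim 0 v.ofLp) ⬝ᵥ (X *ᵥ Sum.elim 0 v.ofLp) := by
    have e : ∀ a, (X *ᵥ Sum.elim 0 v.ofLp) (Sum.inl a) = (X.toBlocks₁₂ *ᵥ v.ofLp) a := by
      intro a
      simp [mulVec, dotProduct, toBlocks₁₂]
    simp only [dotProduct, Fintype.sum_sum_type, e]
    exact le_add_of_nonneg_right (Finset.sum_nonneg fun _ _ => mul_self_nonneg _)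
  have h2 : (Sum.elim (0 : D → ℝ) v.ofLp) ⬝ᵥ (Sum.elim (0 : D → ℝ) v.ofLp) = ‖v‖ ^ 2 := by
    rw [EuclideanSpace.norm_sq_eq]
    simp [dotProduct, pow_two]
  refine le_of_sq_le_sq ?_ (by positivity)
  rw [mul_pow, ← h2]
  refine le_trans (le_of_eq ?_) (h1.trans h)
  rw [EuclideanSpace.norm_sq_eq]
  simp [dotProduct, pow_two, toLpLin_apply]

end Norms

/-! ### The stacked rank-one samples. -/

section Model

variable {m n d : ℕ}

/-- The rank-one sample matrices built from the stacked columns of `A` and `Bᵀ`. -/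
noncomputable def stackedSample (A : Matrix (Fin m) (Fin n) ℝ) (B : Matrix (Fin n) (Fin d) ℝ)
    (p : Fin n → ℝ) (i : Fin n) : Matrix (Fin m ⊕ Fin d) (Fin m ⊕ Fin d) ℝ :=
  (1 / p i) • vecMulVec ((fromRows A Bᵀ).col i) ((fromRows A Bᵀ).col i)

lemma vecMulVec_self_posSemidef {D : Type*} [Fintype D] (z : D → ℝ) :
    (vecMulVec z z).PosSemidef := by
  simpa using posSemidef_vecMulVec_self_star z

lemma stackedSample_isHermitian (A : Matrix (Fin m) (Fin n) ℝ) (B : Matrix (Fin n) (Fin d) ℝ)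
    (p : Fin n → ℝ) (i : Fin n) : (stackedSample A B p i).IsHermitian := by
  rw [stackedSample, IsHermitian, conjTranspose_smul, (vecMulVec_self_posSemidef _).1.eq,
    star_trivial]

lemma dotProduct_stacked_col (A : Matrix (Fin m) (Fin n) ℝ) (B : Matrix (Fin n) (Fin d) ℝ)
    (i : Fin n) : (fromRows A Bᵀ).col i ⬝ᵥ (fromRows A Bᵀ).col i =
      colNorm A i ^ 2 + rowNorm B i ^ 2 := by
  rw [colNorm_sq, rowNorm_sq]
  simp [dotProduct, Fintype.sum_sum_type]

/-- Enlarging both denominators to twice the sum F merges the two fractions; this supplies L = 2F/c.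
-/
lemma Oversamples.dotProduct_stacked_col_le {A : Matrix (Fin m) (Fin n) ℝ}
    {B : Matrix (Fin n) (Fin d) ℝ} {p : Fin n → ℝ} {c : ℝ} (hc : 0 < c) (hA : A ≠ 0) (hB : B ≠ 0)
    (h : Oversamples c p A B) (i : Fin n) :
    (fromRows A Bᵀ).col i ⬝ᵥ (fromRows A Bᵀ).col i ≤
      2 * (frobNorm A ^ 2 + frobNorm B ^ 2) / c * p i := by
  have hFA := pow_pos (frobNorm_pos hA) 2
  have hFB := pow_pos (frobNorm_pos hB) 2
  rw [dotProduct_stacked_col]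
  set F := frobNorm A ^ 2 + frobNorm B ^ 2 with hF
  have h1 : colNorm A i ^ 2 / (2 * F) ≤ colNorm A i ^ 2 / (2 * frobNorm A ^ 2) :=
    div_le_div_of_nonneg_left (sq_nonneg _) (by positivity) (by linarith)
  have h2 : rowNorm B i ^ 2 / (2 * F) ≤ rowNorm B i ^ 2 / (2 * frobNorm B ^ 2) :=
    div_le_div_of_nonneg_left (sq_nonneg _) (by positivity) (by linarith)
  have h3 : c * ((colNorm A i ^ 2 + rowNorm B i ^ 2) / (2 * F)) ≤ p i := by
    refine le_trans (mul_le_mul_of_nonneg_left ?_ hc.le) (h i)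
    rw [add_div]
    exact add_le_add h1 h2
  have hF0 : 0 < F := by positivity
  rw [div_mul_eq_mul_div, le_div_iff₀ hc]
  rw [← mul_div_assoc, div_le_iff₀ (by positivity)] at h3
  linarith

lemma smul_stackedSample {A : Matrix (Fin m) (Fin n) ℝ} {B : Matrix (Fin n) (Fin d) ℝ}
    {p : Fin n → ℝ} {L : ℝ} {i : Fin n}
    (h : (fromRows A Bᵀ).col i ⬝ᵥ (fromRows A Bᵀ).col i ≤ L * p i) :
    p i • stackedSample A B p i = vecMulVec ((fromRows A Bᵀ).col i) ((fromRows A Bᵀ).col i) := by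
  rw [stackedSample, smul_smul]
  -- With `p i = 0` the convention 1/0 = 0 kills the sample; no mass is lost because `h` forces the
  -- column to vanish.
  by_cases hp : p i = 0
  · rw [hp, mul_zero] at h
    have hz : (fromRows A Bᵀ).col i = 0 :=
      dotProduct_self_eq_zero.1 (le_antisymm h (Finset.sum_nonneg fun _ _ => mul_self_nonneg _))
    rw [hz]
    simp
  · rw [mul_one_div_cancel hp, one_smul]

/-- Squaring the rank-one matrix zzᵀ/p multiplies it by ‖z‖²/p, which is at most L when p > 0; at p
= 0 both terms are zero. -/
lemma stackedSample_posSemidef_sub {A : Matrix (Fin m) (Fin n) ℝ} {B : Matrix (Fin n) (Fin d) ℝ}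
    {p : Fin n → ℝ} (hp : ∀ i, 0 ≤ p i) {L : ℝ} {i : Fin n}
    (h : (fromRows A Bᵀ).col i ⬝ᵥ (fromRows A Bᵀ).col i ≤ L * p i) :
    (L • stackedSample A B p i - stackedSample A B p i ^ 2).PosSemidef := by
  rw [stackedSample]
  set z := (fromRows A Bᵀ).col i
  have e : L • (1 / p i) • vecMulVec z z - ((1 / p i) • vecMulVec z z) ^ 2 =
      ((1 / p i) * (L - (1 / p i) * (z ⬝ᵥ z))) • vecMulVec z z := by
    rw [pow_two, smul_mul, Matrix.mul_smul, vecMulVec_mul_vecMulVec, vecMulVec_smul]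
    module
  rw [e]
  refine (vecMulVec_self_posSemidef z).smul ?_
  rcases (hp i).eq_or_lt with h0 | h0
  · simp [← h0]
  · refine mul_nonneg (by positivity) (sub_nonneg.2 ?_)
    rw [div_mul_eq_mul_div, one_mul]
    exact (div_le_iff₀ h0).2 h

lemma sum_smul_stackedSample {A : Matrix (Fin m) (Fin n) ℝ} {B : Matrix (Fin n) (Fin d) ℝ}
    {p : Fin n → ℝ} {L : ℝ}
    (h : ∀ i, (fromRows A Bᵀ).col i ⬝ᵥ (fromRows A Bᵀ).col i ≤ L * p i) :
    ∑ i, p i • stackedSample A B p i = fromRows A Bᵀ * (fromRows A Bᵀ)ᵀ := by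
  rw [Finset.sum_congr rfl fun i _ => smul_stackedSample (h i)]
  ext a b
  simp [Matrix.sum_apply, vecMulVec_apply, Matrix.mul_apply]

lemma trace_stacked_mul_transpose (A : Matrix (Fin m) (Fin n) ℝ) (B : Matrix (Fin n) (Fin d) ℝ) :
    trace (fromRows A Bᵀ * (fromRows A Bᵀ)ᵀ) = frobNorm A ^ 2 + frobNorm B ^ 2 := by
  rw [← frobNorm_transpose B, frobNorm_sq, frobNorm_sq]
  simp [trace, Matrix.mul_apply, Fintype.sum_sum_type, pow_two]

/-- The quadratic form of ZZᵀ is ‖Aᵀx₁ + Bx₂‖² ≤ 2‖Aᵀx₁‖² + 2‖Bx₂‖² ≤ 2‖x‖². -/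
lemma posSemidef_two_sub_stacked {A : Matrix (Fin m) (Fin n) ℝ} {B : Matrix (Fin n) (Fin d) ℝ}
    (hA : specNorm A = 1) (hB : specNorm B = 1) :
    ((2 : ℝ) • (1 : Matrix (Fin m ⊕ Fin d) (Fin m ⊕ Fin d) ℝ) -
      fromRows A Bᵀ * (fromRows A Bᵀ)ᵀ).PosSemidef := by
  refine PosSemidef.of_dotProduct_mulVec_nonneg ?_ fun x => ?_
  · refine IsHermitian.sub (by simp [IsHermitian]) ?_
    exact (posSemidef_self_mul_conjTranspose (fromRows A Bᵀ)).1
  · set u : Fin n → ℝ := Aᵀ *ᵥ (x ∘ Sum.inl)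
    set v : Fin n → ℝ := B *ᵥ (x ∘ Sum.inr)
    have hu : u ⬝ᵥ u ≤ (x ∘ Sum.inl) ⬝ᵥ (x ∘ Sum.inl) :=
      dotProduct_self_mulVec_le_of_specNorm ((specNorm_transpose A).trans hA) _
    have hv : v ⬝ᵥ v ≤ (x ∘ Sum.inr) ⬝ᵥ (x ∘ Sum.inr) :=
      dotProduct_self_mulVec_le_of_specNorm hB _
    have hx : x ⬝ᵥ x = (x ∘ Sum.inl) ⬝ᵥ (x ∘ Sum.inl) + (x ∘ Sum.inr) ⬝ᵥ (x ∘ Sum.inr) := by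
      simp [dotProduct, Fintype.sum_sum_type]
    have hz : (fromRows A Bᵀ)ᵀ *ᵥ x = u + v := by
      rw [transpose_fromRows, transpose_transpose, ← Sum.elim_comp_inl_inr x,
        fromCols_mulVec_sumElim]
    have h1 : x ⬝ᵥ ((fromRows A Bᵀ * (fromRows A Bᵀ)ᵀ) *ᵥ x) = (u + v) ⬝ᵥ (u + v) := by
      rw [← mulVec_mulVec, hz, dotProduct_mulVec, ← mulVec_transpose, hz]
    have h2 : 0 ≤ (u - v) ⬝ᵥ (u - v) := Finset.sum_nonneg fun _ _ => mul_self_nonneg _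
    rw [star_trivial, sub_mulVec, dotProduct_sub, h1, smul_mulVec, one_mulVec, dotProduct_smul,
      smul_eq_mul]
    simp only [add_dotProduct, dotProduct_add, sub_dotProduct, dotProduct_sub] at h2 ⊢
    linarith

/-- The estimation error is an off-diagonal block of the centred sum of the stacked samples. -/
lemma toBlocks₁₂_centredSum {A : Matrix (Fin m) (Fin n) ℝ} {B : Matrix (Fin n) (Fin d) ℝ}
    {p : Fin n → ℝ} {L : ℝ}
    (h : ∀ i, (fromRows A Bᵀ).col i ⬝ᵥ (fromRows A Bᵀ).col i ≤ L * p i) {k : ℕ} (hk : 0 < k)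
    (J : Fin k → Fin n) :
    (centredSum p (stackedSample A B p) J).toBlocks₁₂ =
      (k : ℝ) • (estimator A B p J - A * B) := by
  have hk0 : (k : ℝ) ≠ 0 := by exact_mod_cast hk.ne'
  rw [centredSum, sum_smul_stackedSample h, estimator, smul_sub, smul_smul,
    mul_one_div_cancel hk0, one_smul, Finset.sum_sub_distrib,
    Finset.sum_const, Finset.card_univ, Fintype.card_fin, ← Nat.cast_smul_eq_nsmul ℝ]
  ext a b
  simp [toBlocks₁₂, Matrix.sum_apply, stackedSample, vecMulVec_apply, Matrix.mul_apply]

end Model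

/-! ### Choice of parameters, tail bound and conclusion. -/

/-- The choice of the moment and of the constant. -/
lemma moment_bound_le {c δ δ₀ F t K : ℝ} {n k : ℕ} (hc : 0 < c) (hδ₀ : δ₀ < 1) (hδ : 0 < δ)
    (hδδ₀ : δ ≤ δ₀) (hn : 2 ≤ n) (hF : 0 < F) (hFn : F ≤ 2 * n)
    (hK : K = 1 / Real.log (1 / δ₀) + 1 / Real.log 2 + 1 / (Real.log 2 * Real.log (1 / δ₀)))
    (ht : t ^ 2 * k = 36 * Real.exp 1 * K / c * Real.log n * Real.log (1 / δ) * F)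
    (ht1 : t ^ 2 ≤ 1) :
    ∃ q : ℕ, ((2 * (q + 1) * (2 * F / c)) ^ 2 + 4 * k * 2 * (2 * (q + 1) * (2 * F / c))) ^ q *
      (2 * k * (2 * F / c) * F) ≤ δ * (k * t) ^ (2 * (q + 1)) := by
  have hn0 : (0 : ℝ) < n := by exact_mod_cast (by omega : 0 < n)
  have hk0 : (0 : ℝ) ≤ k := Nat.cast_nonneg k
  set a := Real.log n with ha
  set b := Real.log (1 / δ) with hb
  set a₀ := Real.log 2
  set b₀ := Real.log (1 / δ₀)
  have ha₀ : 0 < a₀ := Real.log_pos one_lt_two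
  have hb₀ : 0 < b₀ := Real.log_pos ((one_lt_div (hδ.trans_le hδδ₀)).2 hδ₀)
  have haa : a₀ ≤ a := Real.log_le_log two_pos (by exact_mod_cast hn)
  have hbb : b₀ ≤ b :=
    Real.log_le_log (by have := hδ.trans_le hδδ₀; positivity) (one_div_le_one_div_of_le hδ hδδ₀)
  have hapos : 0 < a := ha₀.trans_le haa
  have hbpos : 0 < b := hb₀.trans_le hbb
  -- The three summands of `K` trade the sum a + b + 1 for the product ab, using a ≥ log 2 and b ≥
  -- log(1/δ₀).
  have hKl : a + b + 1 ≤ K * (a * b) := by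
    have h1 : a ≤ 1 / b₀ * (a * b) := by
      rw [div_mul_eq_mul_div, one_mul, le_div_iff₀ hb₀]
      exact mul_le_mul_of_nonneg_left hbb hapos.le
    have h2 : b ≤ 1 / a₀ * (a * b) := by
      rw [div_mul_eq_mul_div, one_mul, le_div_iff₀ ha₀, mul_comm]
      exact mul_le_mul_of_nonneg_right haa hbpos.le
    have h3 : 1 ≤ 1 / (a₀ * b₀) * (a * b) := by
      rw [div_mul_eq_mul_div, one_mul, le_div_iff₀ (mul_pos ha₀ hb₀), one_mul]
      exact mul_le_mul haa hbb hb₀.le hapos.le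
    rw [hK]
    linarith
  -- The moment order is chosen so that n e^(-(q+1)) ≤ δ.
  obtain ⟨q, hq⟩ : ∃ q : ℕ, ⌈a + b⌉₊ = q + 1 :=
    Nat.exists_eq_succ_of_ne_zero (Nat.ceil_pos.2 (by positivity)).ne'
  have hq1 : a + b ≤ q + 1 := by
    have := Nat.le_ceil (a + b)
    rw [hq] at this
    exact_mod_cast this
  have hq2 : (q : ℝ) + 1 ≤ K * (a * b) := by
    have := (Nat.ceil_lt_add_one (by positivity : 0 ≤ a + b)).le
    rw [hq] at this
    push_cast at this
    linarith
  refine ⟨q, ?_⟩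
  have he : (0 : ℝ) < Real.exp 1 := Real.exp_pos 1
  have he1 : (1 : ℝ) ≤ Real.exp 1 := Real.one_le_exp zero_le_one
  set T := t ^ 2 * k with hT
  have hT0 : 0 ≤ T := by positivity
  have hTk : T ≤ k := by
    rw [hT]
    exact mul_le_of_le_one_left hk0 ht1
  set r := 2 * ((q : ℝ) + 1) * (2 * F / c) with hr
  have hr0 : 0 ≤ r := by positivity
  have hr1 : 9 * r ≤ T / Real.exp 1 := by
    -- Here 36 = 9 · 4: r contributes 4(q+1)F/c, and the 9 pays for r² + 8kr ≤ 9kr below.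
    rw [ht, hr]
    have : 36 * Real.exp 1 * K / c * a * b * F / Real.exp 1 = 36 * F / c * (K * (a * b)) := by
      field_simp
    rw [this]
    have h := mul_le_mul_of_nonneg_left hq2 (by positivity : 0 ≤ 36 * F / c)
    calc _ = 36 * F / c * ((q : ℝ) + 1) := by ring
      _ ≤ _ := h
  -- This is where t ≤ 1 enters: it makes the linear term 8kr dominate r².
  have hrk : r ≤ k := by
    have : T / Real.exp 1 ≤ T := div_le_self hT0 he1
    linarith
  have hΓ : r ^ 2 + 4 * k * 2 * r ≤ k * T / Real.exp 1 := by
    have h1 : r ^ 2 ≤ k * r := by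
      rw [pow_two]
      exact mul_le_mul_of_nonneg_right hrk hr0
    have h2 := mul_le_mul_of_nonneg_left hr1 hk0
    rw [mul_div_assoc]
    linarith
  have hlast : 2 * k * (2 * F / c) * F ≤ k * T / Real.exp 1 * n := by
    rw [ht]
    have e1 : k * (36 * Real.exp 1 * K / c * a * b * F) / Real.exp 1 * n =
        4 * k * F / c * (9 * n * (K * (a * b))) := by
      field_simp
      ring
    have e2 : 2 * k * (2 * F / c) * F = 4 * k * F / c * F := by ring
    rw [e1, e2]
    refine mul_le_mul_of_nonneg_left ?_ (by positivity)
    have : (1 : ℝ) ≤ K * (a * b) := by linarith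
    have := mul_le_mul_of_nonneg_left this (by positivity : 0 ≤ 9 * (n : ℝ))
    linarith
  have hexp : (n : ℝ) / Real.exp 1 ^ (q + 1) ≤ δ := by
    rw [← Real.exp_nat_mul, mul_one]
    have hδe : δ = n / Real.exp (a + b) := by
      rw [Real.exp_add, ha, hb, Real.exp_log hn0, Real.exp_log (by positivity)]
      field_simp
    rw [hδe]
    refine div_le_div_of_nonneg_left hn0.le (Real.exp_pos _) (Real.exp_le_exp.2 ?_)
    push_cast
    exact hq1
  -- Each of the q + 1 factors is (kt)² = kT times 1/e, so only n/e^(q+1) remains in front.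
  calc (r ^ 2 + 4 * k * 2 * r) ^ q * (2 * k * (2 * F / c) * F)
      ≤ (k * T / Real.exp 1) ^ q * (k * T / Real.exp 1 * n) := by gcongr
    _ = n / Real.exp 1 ^ (q + 1) * (k * t) ^ (2 * (q + 1)) := by
        rw [← mul_assoc, ← pow_succ, div_pow, pow_mul (k * t) 2, show (k * t) ^ 2 = k * T by
          rw [hT]; ring]
        ring
    _ ≤ δ * (k * t) ^ (2 * (q + 1)) :=
        mul_le_mul_of_nonneg_right hexp ((even_two_mul _).pow_nonneg _)

open scoped Matrix.Norms.L2Operator in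
/-- The tail bound in terms of a dominated trace moment. -/
lemma one_sub_le_measureReal_specNorm_le {m n d k : ℕ} {A : Matrix (Fin m) (Fin n) ℝ}
    {B : Matrix (Fin n) (Fin d) ℝ} {p : Fin n → ℝ} {δ t L : ℝ} {Ω : Type*} [MeasurableSpace Ω]
    {μ : Measure Ω} [IsProbabilityMeasure μ] {I : Fin k → Ω → Fin n}
    (hA : specNorm A = 1) (hB : specNorm B = 1) (hp : IsProbVector p) (hI : IsIIDSample μ p I)
    (hk : 0 < k) (hL0 : 0 ≤ L) (ht : 0 < t)
    (h : ∀ i, (fromRows A Bᵀ).col i ⬝ᵥ (fromRows A Bᵀ).col i ≤ L * p i) (q : ℕ)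
    (hq : ((2 * (q + 1) * L) ^ 2 + 4 * k * 2 * (2 * (q + 1) * L)) ^ q *
      (2 * k * L * (frobNorm A ^ 2 + frobNorm B ^ 2)) ≤ δ * (k * t) ^ (2 * (q + 1))) :
    1 - δ ≤ μ.real {ω | specNorm (estimator A B p (fun j => I j ω) - A * B) ≤ t} := by
  have hk0 : (0 : ℝ) < k := by exact_mod_cast hk
  have hY := stackedSample_isHermitian A B p
  have hM := posSemidef_two_sub_stacked hA hB
  rw [← sum_smul_stackedSample h] at hM
  have hmom := iidMean_trace_even_pow_le (k := k) hp.1 hp.2 hY hL0 zero_le_two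
    (fun i => stackedSample_posSemidef_sub hp.1 (h i)) hM (R := 2 * (q + 1)) q (by linarith)
  rw [sum_smul_stackedSample h, trace_stacked_mul_transpose] at hmom
  have hbad := hI.measureReal_mul_le_iidMean hp.1
    (f := fun J => trace (centredSum p (stackedSample A B p) J ^ (2 * q + 2)))
    (fun J => by
      have := trace_mul_even_pow_nonneg PosSemidef.one
        (centredSum_isHermitian (p := p) hY J) (q + 1)
      rwa [Matrix.one_mul] at this)
    (fun J => ¬ specNorm (estimator A B p J - A * B) ≤ t) (τ := (k * t) ^ (2 * (q + 1)))
    (fun J hJ => by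
      refine le_of_not_ge fun hle => hJ ?_
      have hX := l2_opNorm_le_of_trace_pow_le (centredSum_isHermitian (p := p) hY J)
        (by positivity) (Nat.succ_ne_zero q) hle
      have hblock := (l2_opNorm_toBlocks₁₂_le _).trans hX
      rw [toBlocks₁₂_centredSum h hk, norm_smul, Real.norm_of_nonneg hk0.le] at hblock
      exact le_of_mul_le_mul_left hblock hk0)
  have hδ : μ.real {ω | ¬ specNorm (estimator A B p (fun j => I j ω) - A * B) ≤ t} ≤ δ :=
    le_of_mul_le_mul_right ((hbad.trans hmom).trans hq) (by positivity)
  -- Subadditivity replaces the complement rule, so measurability of the event is not needed.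
  have hunion := measureReal_union_le (μ := μ)
    {ω | specNorm (estimator A B p (fun j => I j ω) - A * B) ≤ t}
    {ω | ¬ specNorm (estimator A B p (fun j => I j ω) - A * B) ≤ t}
  have huniv : {ω | specNorm (estimator A B p (fun j => I j ω) - A * B) ≤ t} ∪
      {ω | ¬ specNorm (estimator A B p (fun j => I j ω) - A * B) ≤ t} = Set.univ :=
    Set.union_compl_self _
  rw [huniv, probReal_univ] at hunion
  linarith

/-- With a single column the estimator is exact. -/
lemma estimator_eq_mul_of_one {m d k : ℕ} (A : Matrix (Fin m) (Fin 1) ℝ)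
    (B : Matrix (Fin 1) (Fin d) ℝ) {p : Fin 1 → ℝ} (hp : IsProbVector p) (hk : 0 < k)
    (J : Fin k → Fin 1) : estimator A B p J = A * B := by
  have hk0 : (k : ℝ) ≠ 0 := by exact_mod_cast hk.ne'
  have hp1 : p 0 = 1 := by simpa using hp.2
  ext a b
  simp [estimator, Subsingleton.elim (J _) 0, hp1, vecMulVec_apply, Matrix.mul_apply, hk0]

end AsymAMP

theorem mainTheorem5 (c : ℝ) (hc : 0 < c) (δ₀ : ℝ) (hδ₀ : δ₀ < 1) :
    ∃ c' : ℝ, 0 < c' ∧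
      ∀ (m n d k : ℕ) (A : Matrix (Fin m) (Fin n) ℝ) (B : Matrix (Fin n) (Fin d) ℝ)
        (p : Fin n → ℝ) (δ : ℝ)
        (Ω : Type*) [MeasurableSpace Ω] (μ : MeasureTheory.Measure Ω)
        [MeasureTheory.IsProbabilityMeasure μ] (I : Fin k → Ω → Fin n),
        AsymAMP.specNorm A = 1 → AsymAMP.specNorm B = 1 →
        AsymAMP.IsProbVector p → AsymAMP.Oversamples c p A B →
        AsymAMP.IsIIDSample μ p I →
        0 < δ → δ ≤ δ₀ → 0 < k → AsymAMP.errorBound c' δ k A B ≤ 1 →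
        1 - δ ≤ μ.real {ω | AsymAMP.specNorm
          (AsymAMP.estimator A B p (fun j => I j ω) - A * B) ≤
            AsymAMP.errorBound c' δ k A B} := by
  rcases le_or_gt δ₀ 0 with h0 | h0
  · refine ⟨1, one_pos, ?_⟩
    intro m n d k A B p δ Ω _ μ _ I _ _ _ _ _ hδ hδδ₀
    exact absurd (hδ.trans_le (hδδ₀.trans h0)) (lt_irrefl 0)
  have hb₀ : 0 < Real.log (1 / δ₀) := Real.log_pos ((one_lt_div h0).2 hδ₀)
  have ha₀ : 0 < Real.log 2 := Real.log_pos one_lt_two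
  obtain ⟨K, hK⟩ : ∃ K, K = 1 / Real.log (1 / δ₀) + 1 / Real.log 2 +
      1 / (Real.log 2 * Real.log (1 / δ₀)) := ⟨_, rfl⟩
  have hK0 : 0 < K := by rw [hK]; positivity
  refine ⟨36 * Real.exp 1 * K / c, by positivity, ?_⟩
  intro m n d k A B p δ Ω _ μ _ I hA hB hp hs hI hδ hδδ₀ hk ht1
  have hA0 := AsymAMP.ne_zero_of_specNorm_eq_one hA
  have hB0 := AsymAMP.ne_zero_of_specNorm_eq_one hB
  have hk0 : (0 : ℝ) < k := by exact_mod_cast hk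
  -- For n = 1 the logarithm, and so the error bound, is zero: the estimator has to be exact, and it
  -- is.
  rcases Nat.lt_or_ge n 2 with hn | hn
  · obtain rfl | rfl : n = 0 ∨ n = 1 := by omega
    · exact absurd (Subsingleton.elim A 0) hA0
    · have hall : ∀ J : Fin k → Fin 1,
          AsymAMP.specNorm (AsymAMP.estimator A B p J - A * B) = 0 := by
        intro J
        rw [AsymAMP.estimator_eq_mul_of_one A B hp hk J, sub_self]
        exact AsymAMP.specNorm_zero
      have huniv : {ω | AsymAMP.specNorm (AsymAMP.estimator A B p (fun j => I j ω) - A * B) ≤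
          AsymAMP.errorBound (36 * Real.exp 1 * K / c) δ k A B} = Set.univ := by
        refine Set.eq_univ_of_forall fun ω => ?_
        exact (hall _).le.trans (Real.sqrt_nonneg _)
      rw [huniv, MeasureTheory.probReal_univ]
      linarith
  · have hFA := pow_pos (AsymAMP.frobNorm_pos hA0) 2
    have hFB := pow_pos (AsymAMP.frobNorm_pos hB0) 2
    have hFn : AsymAMP.frobNorm A ^ 2 + AsymAMP.frobNorm B ^ 2 ≤ 2 * n := by
      have h1 := AsymAMP.frobNorm_sq_le hA
      have h2 := AsymAMP.frobNorm_sq_le ((AsymAMP.specNorm_transpose B).trans hB)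
      rw [AsymAMP.frobNorm_transpose] at h2
      linarith
    have hlogn : 0 < Real.log n := Real.log_pos (by exact_mod_cast hn)
    have hlogδ : 0 < Real.log (1 / δ) :=
      Real.log_pos ((one_lt_div hδ).2 (hδδ₀.trans_lt hδ₀))
    have hrad : 0 < 36 * Real.exp 1 * K / c * Real.log n * Real.log (1 / δ) *
        (AsymAMP.frobNorm A ^ 2 + AsymAMP.frobNorm B ^ 2) / k := by positivity
    have ht0 : 0 < AsymAMP.errorBound (36 * Real.exp 1 * K / c) δ k A B := Real.sqrt_pos.2 hrad
    have hsq : AsymAMP.errorBound (36 * Real.exp 1 * K / c) δ k A B ^ 2 * k =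
        36 * Real.exp 1 * K / c * Real.log n * Real.log (1 / δ) *
        (AsymAMP.frobNorm A ^ 2 + AsymAMP.frobNorm B ^ 2) := by
      rw [AsymAMP.errorBound, Real.sq_sqrt hrad.le, div_mul_cancel₀ _ hk0.ne']
    obtain ⟨q, hq⟩ := AsymAMP.moment_bound_le hc hδ₀ hδ hδδ₀ hn (add_pos hFA hFB) hFn hK hsq
      (pow_le_one₀ ht0.le ht1)
    exact AsymAMP.one_sub_le_measureReal_specNorm_le hA hB hp hI hk (by positivity) ht0
      (hs.dotProduct_stacked_col_le hc hA0 hB0) q hq
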